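/- Let $r\ge 0$, $n=n_1+\dots+n_r$, and write $x=(x_1,\dots,x_r)\in\mathbb{R}^n$ with $x_i\in\mathbb{R}^{n_i}$. Let $0<\alpha_1<\dots<\alpha_r$, let $M$ be the diagonal matrix with eigenvalues $e^{\alpha_i}$ of multiplicity $n_i$, and put $D_M(x,y)=\max_i |x_i-y_i|^{1/\alpha_i}$. For $K\ge 1$, a $K$-$Bilip_{D_M}$ almost translation is a map $F:\mathbb{R}^n\to\mathbb{R}^n$ of the form $$F(x_1,\dots,x_r)=(x_1+B_1(x_2,\dots,x_r),\,x_2+B_2(x_3,\dots,x_r),\dots,\,x_r+B_r)$$ with $\frac1K D_M(x,y)\le D_M(F(x),F(y))\le K D_M(x,y)$ for all $x,y$. A quasi-action of a group $\mathcal N$ on a metric space $X$ is a family of maps $A_G:X\to X$ $(G\in\mathcal N)$ for which there are constants $L,C>0$ such that each $A_G$ is an $(L,C)$ quasi-isometry (that is, $\frac1L d(x,x')-C\le d(A_G x,A_G x')\le L\,d(x,x')+C$ for all $x,x'$, and every point of $X$ is within $C$ of $A_G(X)$) and $d(A_G A_F x,A_{GF}x)<C$ for all $G,F\in\mathcal N$,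 $x\in X$. It is proper if for each $R\ge0$ there is $C'$ such that for all $x,y\in X$ at most $C'$ elements $G\in\mathcal N$ satisfy $A_G(N(x,R))\cap N(y,R)\ne\emptyset$, where $N(x,R)$ is the $R$-neighbourhood of $x$. Suppose that a group $\mathcal N$ quasi-acts properly on $\mathbb{R}^n$ (with the Euclidean metric) by maps $A_G$ that are $K$-$Bilip_{D_M}$ almost translations, with $K$ independent of $G$. Then $\mathcal N$ is finitely generated, and it is nilpotent up to a finite normal subgroup: there is a finite normal subgroup $F\trianglelefteq\mathcal N$ such that $\mathcal N/F$ is nilpotent. If moreover $\mathcal N$ is a group of almost translations, that is, $A_{GH}=A_G\circ A_H$ for all $G,H\in\mathcal N$ and $G\mapsto A_G$ is injective, then $\mathcal N$ itself is nilpotent. -/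

import Mathlib

/-- The Euclidean space `ℝⁿ = ℝ^{m 0} ⊕ ⋯ ⊕ ℝ^{m (r-1)}` with `n = ∑ i, m i`, split into blocks;
the norm is the Euclidean norm of `ℝⁿ`. -/
abbrev BlockSpace {r : ℕ} (m : Fin r → ℕ) : Type :=
  PiLp 2 (fun i : Fin r => EuclideanSpace ℝ (Fin (m i)))

/-- The "metric" `D_M(x, y) = max_i |x_i - y_i| ^ (1 / α_i)` on `ℝⁿ`, for the diagonal matrix `M`
with eigenvalues `exp (α i)` of multiplicity `m i`. -/
noncomputable def blockDist {r : ℕ} {m : Fin r → ℕ} (α : Fin r → ℝ) (x y : BlockSpace m) : ℝ :=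
  ⨆ i : Fin r, ‖x i - y i‖ ^ (1 / α i)

/-- `F` is `K`-bilipschitz with respect to `D_M`. -/
def IsBilipD {r : ℕ} {m : Fin r → ℕ} (α : Fin r → ℝ) (K : ℝ)
    (F : BlockSpace m → BlockSpace m) : Prop :=
  ∀ x y, 1 / K * blockDist α x y ≤ blockDist α (F x) (F y) ∧
    blockDist α (F x) (F y) ≤ K * blockDist α x y

/-- `F` is a `K`-bilipschitz (for `D_M`) almost translation, that is, it also has the form
`F(x_1, …, x_r) = (x_1 + B_1(x_2, …, x_r), x_2 + B_2(x_3, …, x_r), …, x_r + B_r)`. -/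
def IsAlmostTranslation {r : ℕ} {m : Fin r → ℕ} (α : Fin r → ℝ) (K : ℝ)
    (F : BlockSpace m → BlockSpace m) : Prop :=
  IsBilipD α K F ∧
    ∃ B : ∀ i : Fin r,
        (∀ j : {j : Fin r // i < j}, EuclideanSpace ℝ (Fin (m j))) → EuclideanSpace ℝ (Fin (m i)),
      ∀ (x : BlockSpace m) (i : Fin r), F x i = x i + B i (fun j => x j)

/-- A `(K, C)` quasi-isometry between metric spaces. -/
def IsQuasiIsometryWith {X Y : Type*} [MetricSpace X] [MetricSpace Y] (K C : ℝ)
    (f : X → Y) : Prop :=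
  (∀ x x', -C + 1 / K * dist x x' ≤ dist (f x) (f x') ∧
    dist (f x) (f x') ≤ K * dist x x' + C) ∧
  ∀ y, ∃ x, dist (f x) y ≤ C

/-- A quasi-action of a group on a metric space: the maps `A g` are quasi-isometries with uniform
constants, and `A g ∘ A h` is uniformly close to `A (g * h)`. -/
def IsQuasiAction {G X : Type*} [Group G] [MetricSpace X] (A : G → X → X) : Prop :=
  ∃ K C : ℝ, 0 < K ∧ 0 < C ∧ (∀ g, IsQuasiIsometryWith K C (A g)) ∧
    ∀ g h x, dist (A g (A h x)) (A (g * h) x) < C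

/-- Properness of a quasi-action: for each `R` there is a uniform bound on the number of group
elements that carry some point of the `R`-neighbourhood of `x` into that of `y`. -/
def IsProperQuasiAction {G X : Type*} [MetricSpace X] (A : G → X → X) : Prop :=
  ∀ R : ℝ, 0 ≤ R → ∃ C : ℕ, ∀ x y : X,
    {g : G | (A g '' Metric.closedBall x R ∩ Metric.closedBall y R).Nonempty}.encard ≤ C

/-!
Each map `A g` is a translation up to a sublinear error. Indeed, the bilipschitz condition makes the
correction term of block `i` Hölder with exponents `α i / α k < 1` in the later blocks `k`,
uniformly in `g`. Therefore `A g x - A g y` differs from `x - y` by at most `‖x - y‖ / 2 + c`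
(`exists_norm_sub_le_half`), and the orbit map `f g = A g 0` satisfies
`‖f (x * g) - f x - f g‖ ≤ ‖f g‖ / 2 + c'`, where the bound does not depend on `x`.

Properness bounds the number of orbit points in a ball of fixed radius, so the sets `{‖f‖ ≤ R}` have
polynomial growth in `R`. As right translation by `g` changes `f` by a bounded amount, a suitable
sequence of these sets is a Følner sequence for the group. The averages of `f (x * g) - f x` over
`x` in these sets converge, along an ultrafilter, to a homomorphism `φ` to `ℝⁿ` with
`‖φ g - f g‖ ≤ ‖f g‖ / 2 + c'` (`exists_hom_norm_sub_le`).

Consequently `φ` is bounded only on finite sets: its kernel is finite and its image is a discrete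
subgroup of `ℝⁿ`, so the group is finitely generated (`group_fg_of_hom_finite_norm_le`), and its
quotient by the kernel is even abelian. If the quasi-action is a faithful action, then the kernel is
trivial, because an almost translation of finite order is the identity
(`IsAlmostTranslation.eq_id_of_iterate_eq_iterate`).
-/

open Filter Topology

/-! ### Polynomial growth -/

/-- A sequence of polynomial growth cannot grow by a factor `q > 1` at every step. -/
lemma exists_succ_le_mul_of_polynomial_growth {u : ℕ → ℝ} (h0 : 1 ≤ u 0) {c : ℝ} {n : ℕ}
    (hu : ∀ k : ℕ, u k ≤ c * ((k : ℝ) + 1) ^ n) {q : ℝ} (hq : 1 < q) :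
    ∃ k, u (k + 1) ≤ q * u k := by
  by_contra! h
  have hlow : ∀ k, q ^ k ≤ u k := by
    intro k
    induction k with
    | zero => simpa using h0
    | succ k ih =>
      calc q ^ (k + 1) = q * q ^ k := pow_succ' q k
        _ ≤ q * u k := by gcongr
        _ ≤ u (k + 1) := (h k).le
  have hlim := ((tendsto_pow_const_div_const_pow_of_one_lt n hq).comp
    (tendsto_add_atTop_nat 1)).const_mul (c * q)
  rw [mul_zero] at hlim
  obtain ⟨k, hk⟩ := (hlim.eventually (gt_mem_nhds one_pos)).exists
  have hqk : 0 < q ^ k := by positivity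
  have h1 := (hlow k).trans (hu k)
  have h2 : c * q * (((k : ℝ) + 1) ^ n / q ^ (k + 1)) = c * ((k : ℝ) + 1) ^ n / q ^ k := by
    rw [pow_succ]
    field_simp
  simp only [Function.comp_apply, Nat.cast_add, Nat.cast_one] at hk
  rw [h2, div_lt_one hqk] at hk
  linarith

/-- A map to `ℝⁿ` that meets every ball of a given radius boundedly often has sublevel sets of
polynomial size. -/
lemma exists_ncard_norm_le {N W : Type*} [NormedAddCommGroup W] [NormedSpace ℝ W]
    [FiniteDimensional ℝ W] (f : N → W)
    (hf : ∀ ρ : ℝ, 0 ≤ ρ → ∃ C : ℕ, ∀ y : W, {g | ‖f g - y‖ ≤ ρ}.encard ≤ C) :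
    ∃ (c : ℝ) (n : ℕ), 0 ≤ c ∧
      ∀ R : ℝ, 0 ≤ R → ({g | ‖f g‖ ≤ R}.ncard : ℝ) ≤ c * (R + 1) ^ n := by
  classical
  let n := Module.finrank ℝ W
  let L : W ≃L[ℝ] (Fin n → ℝ) := ContinuousLinearEquiv.ofFinrankEq (by simp [n])
  let a := ‖(L : W →L[ℝ] (Fin n → ℝ))‖
  have ha : 0 ≤ a := norm_nonneg _
  obtain ⟨C, hC⟩ := hf ‖(L.symm : (Fin n → ℝ) →L[ℝ] W)‖ (norm_nonneg _)
  refine ⟨C * (2 * a + 3) ^ n, n, by positivity, fun R hR => ?_⟩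
  have hfin : {g | ‖f g‖ ≤ R}.Finite := by
    obtain ⟨C', hC'⟩ := hf R hR
    have := hC' 0
    simp only [sub_zero] at this
    exact Set.finite_of_encard_le_coe this
  -- Points whose images have the same integer parts of coordinates are boundedly close.
  let φ : N → (Fin n → ℤ) := fun g i => ⌊L (f g) i⌋
  let M : ℕ := ⌈a * R⌉₊
  have hM : a * R ≤ M := Nat.le_ceil _
  have hM' : (M : ℝ) < a * R + 1 := Nat.ceil_lt_add_one (by positivity)
  have himg : hfin.toFinset.image φ ⊆
      Fintype.piFinset (fun _ : Fin n => Finset.Icc (-(M : ℤ)) M) := by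
    intro p hp
    obtain ⟨g, hg, rfl⟩ := Finset.mem_image.1 hp
    have hg' : ‖f g‖ ≤ R := by simpa using hg
    rw [Fintype.mem_piFinset]
    intro i
    have h1 : |L (f g) i| ≤ M :=
      calc |L (f g) i| ≤ ‖L (f g)‖ := norm_le_pi_norm (L (f g)) i
        _ ≤ a * ‖f g‖ := (L : W →L[ℝ] (Fin n → ℝ)).le_opNorm (f g)
        _ ≤ a * R := by gcongr
        _ ≤ M := hM
    rw [abs_le] at h1
    rw [Finset.mem_Icc]
    constructor
    · rw [Int.le_floor]
      push_cast
      exact h1.1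
    · have := (Int.floor_le (L (f g) i)).trans h1.2
      exact_mod_cast this
  have hfib : ∀ p ∈ hfin.toFinset.image φ, (hfin.toFinset.filter (φ · = p)).card ≤ C := by
    intro p hp
    obtain ⟨g, -, rfl⟩ := Finset.mem_image.1 hp
    have hsub : ((hfin.toFinset.filter (φ · = φ g) : Finset N) : Set N) ⊆
        {h | ‖f h - f g‖ ≤ ‖(L.symm : (Fin n → ℝ) →L[ℝ] W)‖} := by
      intro h hh
      have hh' : φ h = φ g := (Finset.mem_filter.1 (Finset.mem_coe.1 hh)).2
      have h1 : ‖L (f h) - L (f g)‖ ≤ 1 := by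
        rw [pi_norm_le_iff_of_nonneg zero_le_one]
        intro i
        exact (Int.abs_sub_lt_one_of_floor_eq_floor (congrFun hh' i)).le
      have h2 := (L.symm : (Fin n → ℝ) →L[ℝ] W).le_opNorm (L (f h) - L (f g))
      have h3 : (L.symm : (Fin n → ℝ) →L[ℝ] W) (L (f h) - L (f g)) = f h - f g := by simp
      rw [h3] at h2
      exact h2.trans (mul_le_of_le_one_right (norm_nonneg _) h1)
    have := (Set.encard_le_encard hsub).trans (hC (f g))
    rw [Set.encard_coe_eq_coe_finsetCard] at this
    exact_mod_cast this
  have hcard : hfin.toFinset.card ≤ C * (2 * M + 1) ^ n := by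
    refine (Finset.card_le_mul_card_image _ C hfib).trans (Nat.mul_le_mul_left _ ?_)
    refine (Finset.card_le_card himg).trans_eq ?_
    rw [Fintype.card_piFinset]
    simp only [Int.card_Icc, Finset.prod_const, Finset.card_univ, Fintype.card_fin]
    congr 1
    omega
  rw [Set.ncard_eq_toFinset_card _ hfin]
  calc (hfin.toFinset.card : ℝ) ≤ C * (2 * M + 1) ^ n := by exact_mod_cast hcard
    _ ≤ C * ((2 * a + 3) * (R + 1)) ^ n := by
      gcongr
      nlinarith
    _ = C * (2 * a + 3) ^ n * (R + 1) ^ n := by rw [mul_pow, mul_assoc]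

/-! ### Averaging over Følner sets -/

/-- If `T` contains `S` and its translate, then translating a bounded function changes its sum over
`S` by at most twice the bound times the number of points of `T` outside `S`. -/
lemma norm_sum_translate_sub_sum_le {N W : Type*} [Group N] [NormedAddCommGroup W]
    {u : N → W} {β : ℝ} (hu : ∀ x, ‖u x‖ ≤ β) {S T : Finset N} (g : N) (hST : S ⊆ T)
    (hgT : ∀ x ∈ S, x * g ∈ T) :
    ‖∑ x ∈ S, u (x * g) - ∑ x ∈ S, u x‖ ≤ 2 * β * ((T.card : ℝ) - S.card) := by
  classical
  have key : ∀ S' ⊆ T, ‖∑ x ∈ T \ S', u x‖ ≤ β * ((T.card : ℝ) - S'.card) := by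
    intro S' h
    rw [← Nat.cast_sub (Finset.card_le_card h), ← Finset.card_sdiff_of_subset h, mul_comm,
      ← nsmul_eq_mul]
    exact norm_sum_le_of_le _ (fun x _ => hu x) |>.trans_eq (by simp)
  let e : N ↪ N := ⟨(· * g), mul_left_injective g⟩
  have hS : S.map e ⊆ T := by
    intro y hy
    obtain ⟨x, hx, rfl⟩ := Finset.mem_map.1 hy
    exact hgT x hx
  have h1 := Finset.sum_sdiff (f := u) hS
  have h2 := Finset.sum_sdiff (f := u) hST
  have h3 : ∑ x ∈ S.map e, u x = ∑ x ∈ S, u (x * g) := Finset.sum_map _ _ _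
  have h4 : ∑ x ∈ S, u (x * g) - ∑ x ∈ S, u x = ∑ x ∈ T \ S, u x - ∑ x ∈ T \ S.map e, u x := by
    rw [← h3, sub_eq_sub_iff_add_eq_add, add_comm, h1, h2]
  have k1 := key S hST
  have k2 := key _ hS
  rw [Finset.card_map] at k2
  rw [h4]
  exact (norm_sub_le _ _).trans (by linarith)

/-- Averaging over the sublevel sets of `‖f‖`, which form a Følner sequence because they have
polynomial growth, turns a map whose increments `f (x * g) - f x` stay near `f g` into a
homomorphism near `f`. -/
theorem exists_hom_norm_sub_le {N W : Type*} [Group N] [NormedAddCommGroup W] [NormedSpace ℝ W]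
    [FiniteDimensional ℝ W] (f : N → W)
    (hf : ∀ ρ : ℝ, 0 ≤ ρ → ∃ C : ℕ, ∀ y : W, {g | ‖f g - y‖ ≤ ρ}.encard ≤ C)
    (d : N → ℝ) (hd : ∀ x g, ‖f (x * g) - f x - f g‖ ≤ d g) :
    ∃ φ : N →* Multiplicative W, ∀ g, ‖(φ g).toAdd - f g‖ ≤ d g := by
  classical
  have : ProperSpace W := FiniteDimensional.proper_real W
  have hfin : ∀ R : ℝ, {g | ‖f g‖ ≤ R}.Finite := by
    intro R
    obtain ⟨C, hC⟩ := hf |R| (abs_nonneg R)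
    have := hC 0
    simp only [sub_zero] at this
    exact (Set.finite_of_encard_le_coe this).subset fun g hg => le_trans hg (le_abs_self R)
  let E : ℝ → Finset N := fun R => (hfin R).toFinset
  have hE : ∀ R g, g ∈ E R ↔ ‖f g‖ ≤ R := fun R g => by simp [E]
  have hEmono : ∀ {R R'}, R ≤ R' → E R ⊆ E R' := fun h g hg =>
    (hE _ _).2 (((hE _ _).1 hg).trans h)
  obtain ⟨c, n, hc, hgrow⟩ := exists_ncard_norm_le f hf
  have hfolner : ∀ j : ℕ, ∃ R : ℝ, 0 < (E R).card ∧
      ((E (R + j)).card : ℝ) ≤ (1 + 1 / ((j : ℝ) + 1)) * (E R).card := by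
    intro j
    let R₀ := ‖f 1‖
    have hpos : ∀ k : ℕ, 0 < (E (R₀ + k * j)).card := fun k =>
      Finset.card_pos.2 ⟨1, (hE _ _).2 (le_add_of_nonneg_right (by positivity))⟩
    have hR₀ : 0 ≤ R₀ := norm_nonneg _
    have hu : ∀ k : ℕ, ((E (R₀ + k * j)).card : ℝ) ≤
        c * (R₀ + j + 1) ^ n * ((k : ℝ) + 1) ^ n := by
      intro k
      have h1 := hgrow (R₀ + k * j) (by positivity)
      rw [Set.ncard_eq_toFinset_card _ (hfin _)] at h1
      refine h1.trans ?_
      rw [mul_assoc, ← mul_pow]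
      gcongr
      have : (0 : ℝ) ≤ k * R₀ := by positivity
      nlinarith [(Nat.cast_nonneg k : (0 : ℝ) ≤ k), (Nat.cast_nonneg j : (0 : ℝ) ≤ j)]
    obtain ⟨k, hk⟩ := exists_succ_le_mul_of_polynomial_growth
      (u := fun k => ((E (R₀ + k * j)).card : ℝ)) (by exact_mod_cast hpos 0) hu
      (q := 1 + 1 / ((j : ℝ) + 1)) (lt_add_of_pos_right _ (by positivity))
    refine ⟨R₀ + k * j, hpos k, ?_⟩
    convert hk using 4
    push_cast
    ring
  choose R hRpos hR using hfolner
  let b : N → ℝ := fun g => d g + ‖f g‖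
  have hb : ∀ x g, ‖f (x * g) - f x‖ ≤ b g := by
    intro x g
    have := norm_add_le (f (x * g) - f x - f g) (f g)
    rw [sub_add_cancel] at this
    exact this.trans (add_le_add_left (hd x g) _)
  -- The averages of the increments.
  let μ : ℕ → N → W := fun j g => ((E (R j)).card : ℝ)⁻¹ • ∑ x ∈ E (R j), (f (x * g) - f x)
  have hμ : ∀ j g, μ j g ∈ Metric.closedBall (f g) (d g) := by
    intro j g
    have h0 : ((E (R j)).card : ℝ) ≠ 0 := by exact_mod_cast (hRpos j).ne'
    have h1 : μ j g - f g =
        ((E (R j)).card : ℝ)⁻¹ • ∑ x ∈ E (R j), (f (x * g) - f x - f g) := by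
      rw [Finset.sum_sub_distrib _ (fun _ => f g), Finset.sum_const, smul_sub,
        ← Nat.cast_smul_eq_nsmul ℝ, inv_smul_smul₀ h0]
    rw [mem_closedBall_iff_norm, h1, norm_smul, norm_inv, Real.norm_natCast,
      inv_mul_le_iff₀ (by exact_mod_cast hRpos j)]
    exact norm_sum_le_of_le _ (fun x _ => hd x g) |>.trans_eq (by simp)
  have hadd : ∀ g h, Tendsto (fun j => μ j (g * h) - μ j g - μ j h) atTop (𝓝 0) := by
    intro g h
    have hlim : Tendsto (fun j : ℕ => 2 * b h * (1 / ((j : ℝ) + 1))) atTop (𝓝 0) := by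
      simpa using tendsto_one_div_add_atTop_nhds_zero_nat.const_mul (2 * b h)
    refine squeeze_zero_norm' ?_ hlim
    filter_upwards [eventually_ge_atTop ⌈b g⌉₊] with j hj
    have hbg : b g ≤ j := Nat.ceil_le.1 hj
    have hpos : (0 : ℝ) < (E (R j)).card := by exact_mod_cast hRpos j
    have h1 : μ j (g * h) - μ j g - μ j h = ((E (R j)).card : ℝ)⁻¹ •
        (∑ x ∈ E (R j), (f (x * g * h) - f (x * g)) - ∑ x ∈ E (R j), (f (x * h) - f x)) := by
      simp only [μ, ← smul_sub, ← Finset.sum_sub_distrib, mul_assoc]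
      congr 1
      exact Finset.sum_congr rfl fun x _ => by abel
    have h2 := norm_sum_translate_sub_sum_le (u := fun x => f (x * h) - f x)
      (fun x => hb x h) (S := E (R j)) (T := E (R j + j)) g
      (hEmono (le_add_of_nonneg_right (Nat.cast_nonneg j))) (by
        intro x hx
        rw [hE] at hx ⊢
        have := norm_add_le (f (x * g) - f x) (f x)
        rw [sub_add_cancel] at this
        linarith [hb x g])
    have hbh : 0 ≤ b h := (norm_nonneg _).trans (hb 1 h)
    rw [h1, norm_smul, norm_inv, Real.norm_natCast, inv_mul_le_iff₀ hpos]
    refine h2.trans ?_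
    calc 2 * b h * (((E (R j + j)).card : ℝ) - (E (R j)).card)
        ≤ 2 * b h * (1 / ((j : ℝ) + 1) * (E (R j)).card) := by
          gcongr
          linarith [hR j]
      _ = _ := by ring
  -- A limit of the averages along an ultrafilter.
  let 𝒰 : Ultrafilter ℕ := Ultrafilter.of atTop
  have h𝒰 : (𝒰 : Filter ℕ) ≤ atTop := Ultrafilter.of_le atTop
  have hex : ∀ g, ∃ w ∈ Metric.closedBall (f g) (d g), Tendsto (fun j => μ j g) 𝒰 (𝓝 w) :=
    fun g => (isCompact_closedBall (f g) (d g)).ultrafilter_le_nhds' (𝒰.map fun j => μ j g)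
      (Filter.mem_map.2 (Filter.Eventually.of_forall fun j => hμ j g))
  choose ψ hψ hψlim using hex
  have hψadd : ∀ g h, ψ (g * h) = ψ g + ψ h := by
    intro g h
    have h1 := ((hψlim (g * h)).sub (hψlim g)).sub (hψlim h)
    have h2 := tendsto_nhds_unique h1 ((hadd g h).mono_left h𝒰)
    rw [sub_sub, sub_eq_zero] at h2
    exact h2
  refine ⟨MonoidHom.mk' (fun g => Multiplicative.ofAdd (ψ g)) fun g h => ?_, fun g => ?_⟩
  · rw [hψadd, ofAdd_add]
  · exact mem_closedBall_iff_norm.1 (hψ g)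

/-! ### Finite generation -/

/-- If balls have finite preimages under a homomorphism to `ℝⁿ`, then its kernel is finite and its
image is discrete, hence finitely generated; so the group is finitely generated. -/
theorem group_fg_of_hom_finite_norm_le {N W : Type*} [Group N] [NormedAddCommGroup W]
    [NormedSpace ℝ W] [FiniteDimensional ℝ W] (φ : N →* Multiplicative W)
    (hφ : ∀ R : ℝ, {g | ‖(φ g).toAdd‖ ≤ R}.Finite) : Group.FG N := by
  let L : Submodule ℤ W := AddSubgroup.toIntSubmodule (MonoidHom.toAdditiveLeft φ).range
  have hL : ∀ w, w ∈ L ↔ ∃ g, (φ g).toAdd = w := by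
    intro w
    constructor
    · rintro ⟨g, hg⟩
      exact ⟨g.toMul, hg⟩
    · rintro ⟨g, hg⟩
      exact ⟨Additive.ofMul g, hg⟩
  have : DiscreteTopology L := by
    have hfinL : (Metric.closedBall (0 : L) 1).Finite := by
      refine Set.Finite.of_finite_image (f := ((↑) : L → W)) ?_ Subtype.val_injective.injOn
      refine ((hφ 1).image fun g => (φ g).toAdd).subset ?_
      rintro _ ⟨w, hw, rfl⟩
      obtain ⟨g, hg⟩ := (hL w).1 w.2
      refine ⟨g, ?_, hg⟩
      have : ‖(w : W)‖ ≤ 1 := by simpa using hw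
      rw [← hg] at this
      exact this
    refine discreteTopology_of_isOpen_singleton_zero ?_
    have h1 : IsOpen (Metric.ball (0 : L) 1 \ (Metric.ball (0 : L) 1 \ {0})) :=
      Metric.isOpen_ball.sdiff
        ((hfinL.subset (Set.sdiff_subset.trans Metric.ball_subset_closedBall)).isClosed)
    convert h1 using 1
    ext x
    simp only [Set.mem_singleton_iff, Set.mem_sdiff, Metric.mem_ball, not_and, not_not]
    constructor
    · rintro rfl
      simp
    · exact fun h => h.2 h.1
  have hLfg : L.FG := Module.Finite.iff_fg.1 inferInstance
  obtain ⟨T, hT⟩ := hLfg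
  have hTL : ∀ t ∈ T, ∃ g, (φ g).toAdd = t := fun t ht =>
    (hL t).1 (hT ▸ Submodule.subset_span ht)
  choose! s hs using hTL
  -- Lifts of generators of the image, together with the finite kernel, generate.
  refine Group.fg_iff.2 ⟨s '' T ∪ {g | ‖(φ g).toAdd‖ ≤ 0}, ?_,
    (T.finite_toSet.image s).union (hφ 0)⟩
  set H := Subgroup.closure (s '' T ∪ {g | ‖(φ g).toAdd‖ ≤ 0})
  have hsurj : ∀ w ∈ Submodule.span ℤ (T : Set W), ∃ h ∈ H, (φ h).toAdd = w := by
    intro w hw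
    induction hw using Submodule.span_induction with
    | mem t ht =>
      exact ⟨s t, Subgroup.subset_closure (Or.inl ⟨t, ht, rfl⟩), hs t ht⟩
    | zero => exact ⟨1, H.one_mem, by simp⟩
    | add x y _ _ hx hy =>
      obtain ⟨a, ha, rfl⟩ := hx
      obtain ⟨b, hb, rfl⟩ := hy
      exact ⟨a * b, H.mul_mem ha hb, by simp⟩
    | smul k x _ hx =>
      obtain ⟨a, ha, rfl⟩ := hx
      exact ⟨a ^ k, H.zpow_mem ha k, by simp⟩
  rw [eq_top_iff]
  intro g _
  obtain ⟨h, hh, hhg⟩ := hsurj (φ g).toAdd (by rw [hT]; exact (hL _).2 ⟨g, rfl⟩)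
  have hker : h⁻¹ * g ∈ H := Subgroup.subset_closure
    (Or.inr (by simp [Multiplicative.toAdd.injective hhg]))
  simpa using H.mul_mem hh hker

/-! ### Almost translations -/

/-- Powers `t ^ θ` with `θ < 1` are eventually below every line of positive slope. -/
lemma exists_mul_rpow_le {θ : ℝ} (h0 : 0 < θ) (h1 : θ < 1) {a ε : ℝ} (ha : 0 ≤ a) (hε : 0 < ε) :
    ∃ c : ℝ, 0 ≤ c ∧ ∀ t : ℝ, 0 ≤ t → a * t ^ θ ≤ ε * t + c := by
  let D : ℝ := (a * (ε ^ θ)⁻¹) ^ (1 - θ)⁻¹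
  have hD : 0 ≤ D := by positivity
  have hDpow : D ^ (1 - θ) = a * (ε ^ θ)⁻¹ := by
    rw [← Real.rpow_mul (by positivity), inv_mul_cancel₀ (by linarith), Real.rpow_one]
  refine ⟨D, hD, fun t ht => ?_⟩
  have hεθ : ε ^ θ ≠ 0 := (Real.rpow_pos_of_pos hε θ).ne'
  have key := Real.geom_mean_le_arith_mean2_weighted h0.le (sub_nonneg.2 h1.le)
    (mul_nonneg hε.le ht) hD (by ring)
  rw [hDpow, Real.mul_rpow hε.le ht] at key
  have h2 : ε ^ θ * t ^ θ * (a * (ε ^ θ)⁻¹) = a * t ^ θ := by field_simp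
  rw [h2] at key
  have := mul_nonneg hε.le ht
  nlinarith

lemma norm_blockSpace_le_sum {r : ℕ} {m : Fin r → ℕ} (v : BlockSpace m) : ‖v‖ ≤ ∑ i, ‖v i‖ := by
  refine le_of_sq_le_sq ?_ (Finset.sum_nonneg fun i _ => norm_nonneg _)
  rw [PiLp.norm_sq_eq_of_L2]
  exact Finset.sum_sq_le_sq_sum_of_nonneg fun i _ => norm_nonneg _

/-- Blockwise, an almost translation differs from a translation by a sublinear amount: the `i`-th
correction term depends only on the later blocks, on which it is Hölder of exponents
`α i / α k < 1`. -/
lemma exists_norm_block_sub_le {r : ℕ} {m : Fin r → ℕ} {α : Fin r → ℝ} (hα_pos : ∀ i, 0 < α i)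
    (hα_mono : StrictMono α) {K : ℝ} (hK : 1 ≤ K) {ε : ℝ} (hε : 0 < ε) (i : Fin r) :
    ∃ c : ℝ, ∀ F : BlockSpace m → BlockSpace m, IsAlmostTranslation α K F →
      ∀ x y, ‖(F x - F y - (x - y)) i‖ ≤ ε * ‖x - y‖ + c := by
  have hK0 : 0 < K := by linarith
  have hc : ∀ k : Fin r, ∃ c : ℝ, 0 ≤ c ∧ (i < k → ∀ t : ℝ, 0 ≤ t →
      K ^ α i * t ^ (α i / α k) ≤ ε * t + c) := by
    intro k
    by_cases hik : i < k
    · obtain ⟨c, hc0, hc⟩ := exists_mul_rpow_le (θ := α i / α k)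
        (div_pos (hα_pos i) (hα_pos k)) ((div_lt_one (hα_pos k)).2 (hα_mono hik))
        (a := K ^ α i) (by positivity) hε
      exact ⟨c, hc0, fun _ => hc⟩
    · exact ⟨0, le_rfl, fun h => absurd h hik⟩
  choose c hc0 hc using hc
  refine ⟨∑ k, c k, fun F hF x y => ?_⟩
  obtain ⟨hbi, B, hB⟩ := hF
  have hαi := hα_pos i
  set s : ℝ := ε * ‖x - y‖ + ∑ k, c k
  have hs0 : 0 ≤ s := add_nonneg (by positivity) (Finset.sum_nonneg fun k _ => hc0 k)
  -- Erasing the blocks up to `i` does not affect the `i`-th correction term.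
  let cut : BlockSpace m → BlockSpace m := fun z => WithLp.toLp 2 fun k => if i < k then z k else 0
  have hcut : ∀ z k, cut z k = if i < k then z k else 0 := fun z k => rfl
  have hBcut : ∀ z : BlockSpace m, F (cut z) i = B i (fun j => z j) := by
    intro z
    rw [hB, hcut, if_neg (lt_irrefl i), zero_add]
    congr 1
    funext j
    rw [hcut, if_pos j.2]
  have hdiff : (F x - F y - (x - y)) i = F (cut x) i - F (cut y) i := by
    rw [hBcut, hBcut]
    simp only [PiLp.sub_apply, hB]
    abel
  have hne : Nonempty (Fin r) := ⟨i⟩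
  have hD : blockDist α (cut x) (cut y) ≤ s ^ (1 / α i) / K := by
    refine ciSup_le fun k => ?_
    rw [le_div_iff₀ hK0, hcut, hcut]
    by_cases hik : i < k
    · rw [if_pos hik, if_pos hik]
      have h1 : ‖x k - y k‖ ≤ ‖x - y‖ := PiLp.norm_apply_le (x - y) k
      have h2 : K ^ α i * ‖x - y‖ ^ (α i / α k) ≤ s :=
        (hc k hik _ (norm_nonneg _)).trans (add_le_add_right
          (Finset.single_le_sum (fun k _ => hc0 k) (Finset.mem_univ k)) _)
      calc ‖x k - y k‖ ^ (1 / α k) * K ≤ ‖x - y‖ ^ (1 / α k) * K := by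
            have := hα_pos k
            gcongr
        _ = (K ^ α i * ‖x - y‖ ^ (α i / α k)) ^ (1 / α i) := by
            rw [Real.mul_rpow (by positivity) (by positivity), ← Real.rpow_mul hK0.le,
              ← Real.rpow_mul (norm_nonneg _), mul_one_div_cancel hαi.ne', Real.rpow_one, mul_comm]
            congr 2
            field_simp
        _ ≤ s ^ (1 / α i) := by gcongr
    · rw [if_neg hik, if_neg hik, sub_zero, norm_zero,
        Real.zero_rpow (one_div_pos.2 (hα_pos k)).ne', zero_mul]
      positivity
  have h3 : ‖F (cut x) i - F (cut y) i‖ ^ (1 / α i) ≤ s ^ (1 / α i) :=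
    calc ‖F (cut x) i - F (cut y) i‖ ^ (1 / α i) ≤ blockDist α (F (cut x)) (F (cut y)) :=
          le_ciSup (f := fun k => ‖F (cut x) k - F (cut y) k‖ ^ (1 / α k))
            (Set.finite_range _).bddAbove i
      _ ≤ K * blockDist α (cut x) (cut y) := (hbi _ _).2
      _ ≤ K * (s ^ (1 / α i) / K) := by gcongr
      _ = s ^ (1 / α i) := by field_simp
  rw [hdiff]
  exact (Real.rpow_le_rpow_iff (norm_nonneg _) hs0 (one_div_pos.2 hαi)).1 h3

/-- An almost translation differs from a translation by a sublinear amount, in the weak form that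
is needed: slope `1 / 2` and a constant that is the same for all `K`-bilipschitz almost
translations. -/
lemma exists_norm_sub_le_half {r : ℕ} {m : Fin r → ℕ} {α : Fin r → ℝ} (hα_pos : ∀ i, 0 < α i)
    (hα_mono : StrictMono α) {K : ℝ} (hK : 1 ≤ K) :
    ∃ c : ℝ, ∀ F : BlockSpace m → BlockSpace m, IsAlmostTranslation α K F →
      ∀ x y, ‖F x - F y - (x - y)‖ ≤ ‖x - y‖ / 2 + c := by
  -- Each of the `r` blocks contributes this slope, so that the total is at most `1 / 2`.
  have hε : (0 : ℝ) < 1 / (2 * (r + 1)) := by positivity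
  choose c hc using exists_norm_block_sub_le (m := m) hα_pos hα_mono hK hε
  refine ⟨∑ i, c i, fun F hF x y => ?_⟩
  calc ‖F x - F y - (x - y)‖ ≤ ∑ i, ‖(F x - F y - (x - y)) i‖ := norm_blockSpace_le_sum _
    _ ≤ ∑ i, (1 / (2 * ((r : ℝ) + 1)) * ‖x - y‖ + c i) :=
        Finset.sum_le_sum fun i _ => hc i F hF x y
    _ = r * (1 / (2 * ((r : ℝ) + 1)) * ‖x - y‖) + ∑ i, c i := by
        simp [Finset.sum_add_distrib]
    _ ≤ ‖x - y‖ / 2 + ∑ i, c i := by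
        gcongr
        have h1 : (r : ℝ) * (1 / (2 * ((r : ℝ) + 1)) * ‖x - y‖) =
            (r / (r + 1)) * (‖x - y‖ / 2) := by field_simp
        rw [h1]
        refine mul_le_of_le_one_left (by positivity) ?_
        rw [div_le_one (by positivity)]
        linarith

/-- Two different iterates of an almost translation agree only if it is the identity: once the
blocks after the `i`-th are known to be fixed, the `k`-th iterate moves the `i`-th block by `k`
times the correction term of `F`. -/
lemma IsAlmostTranslation.eq_id_of_iterate_eq_iterate {r : ℕ} {m : Fin r → ℕ}
    {α : Fin r → ℝ} {K : ℝ} {F : BlockSpace m → BlockSpace m} (hF : IsAlmostTranslation α K F)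
    {k l : ℕ} (hkl : k ≠ l)
    (hFkl : F^[k] = F^[l]) : F = id := by
  obtain ⟨-, B, hB⟩ := hF
  have main : ∀ i : Fin r, ∀ x, F x i = x i := by
    intro i
    induction i using WellFoundedGT.induction with
    | ind i ih =>
    intro x
    have hlater : ∀ p : ℕ, ∀ j : {j : Fin r // i < j}, F^[p] x j = x j := by
      intro p j
      induction p with
      | zero => rfl
      | succ p hp => rw [Function.iterate_succ_apply', ih j j.2, hp]
    have hiter : ∀ p : ℕ, F^[p] x i = x i + p • B i (fun j => x j) := by
      intro p
      induction p with
      | zero => simp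
      | succ p hp =>
        rw [Function.iterate_succ_apply', hB, hp, funext (hlater p), succ_nsmul, add_assoc]
    have h1 := hiter k
    rw [hFkl, hiter l, add_right_inj, ← Nat.cast_smul_eq_nsmul ℝ, ← Nat.cast_smul_eq_nsmul ℝ,
      ← sub_eq_zero, ← sub_smul, smul_eq_zero, sub_eq_zero, Nat.cast_inj] at h1
    rw [hB, h1.resolve_left hkl.symm, add_zero]
  funext x
  exact PiLp.ext fun i => main i x

/-! ### Proper quasi-actions by almost translations -/

theorem mainTheorem3 {r : ℕ} (m : Fin r → ℕ) (α : Fin r → ℝ) (hα_pos : ∀ i, 0 < α i)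
    (hα_mono : StrictMono α) (K : ℝ) (hK : 1 ≤ K) {N : Type*} [Group N]
    (A : N → BlockSpace m → BlockSpace m) (hA : IsQuasiAction A)
    (hproper : IsProperQuasiAction A) (hbilip : ∀ g, IsAlmostTranslation α K (A g)) :
    Group.FG N ∧
    (∃ F : Subgroup N, ∃ _ : F.Normal, Finite F ∧ Group.IsNilpotent (N ⧸ F)) ∧
    ((∀ g h, A (g * h) = A g ∘ A h) → Function.Injective A → Group.IsNilpotent N) := by
  obtain ⟨-, C, -, -, -, hclose⟩ := hA
  obtain ⟨c, hc⟩ := exists_norm_sub_le_half (m := m) hα_pos hα_mono hK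
  let f : N → BlockSpace m := fun g => A g 0
  have hf : ∀ ρ : ℝ, 0 ≤ ρ → ∃ C : ℕ, ∀ y, {g | ‖f g - y‖ ≤ ρ}.encard ≤ C := by
    intro ρ hρ
    obtain ⟨C', hC'⟩ := hproper ρ hρ
    refine ⟨C', fun y => (Set.encard_le_encard fun g hg => ?_).trans (hC' 0 y)⟩
    exact ⟨f g, ⟨0, Metric.mem_closedBall_self hρ, rfl⟩, mem_closedBall_iff_norm.2 hg⟩
  have hd : ∀ x g, ‖f (x * g) - f x - f g‖ ≤ ‖f g‖ / 2 + (C + c) := by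
    intro x g
    have h1 : ‖f (x * g) - A x (f g)‖ ≤ C := by
      rw [← dist_eq_norm, dist_comm]
      exact (hclose x g 0).le
    have h2 := hc (A x) (hbilip x) (f g) 0
    have h3 := norm_add_le (f (x * g) - A x (f g)) (A x (f g) - A x 0 - (f g - 0))
    rw [sub_zero] at h2 h3
    have h4 : f (x * g) - A x (f g) + (A x (f g) - A x 0 - f g) = f (x * g) - f x - f g := by
      simp only [f]
      abel
    rw [h4] at h3
    linarith
  obtain ⟨φ, hφ⟩ := exists_hom_norm_sub_le f hf _ hd
  have hfin : ∀ R : ℝ, {g | ‖(φ g).toAdd‖ ≤ R}.Finite := by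
    intro R
    obtain ⟨C', hC'⟩ := hf |2 * (R + (C + c))| (abs_nonneg _)
    have h0 := hC' 0
    simp only [sub_zero] at h0
    refine (Set.finite_of_encard_le_coe h0).subset fun g hg => ?_
    have h1 : ‖(φ g).toAdd‖ ≤ R := hg
    have h2 := norm_sub_le (φ g).toAdd ((φ g).toAdd - f g)
    rw [sub_sub_cancel] at h2
    have h3 : ‖(φ g).toAdd - f g‖ ≤ ‖f g‖ / 2 + (C + c) := hφ g
    have h4 : ‖f g‖ ≤ 2 * (R + (C + c)) := by linarith
    exact h4.trans (le_abs_self _)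
  have hker : (φ.ker : Set N).Finite := (hfin 0).subset fun g hg => by
    have : φ g = 1 := hg
    simp [this]
  refine ⟨group_fg_of_hom_finite_norm_le φ hfin, ⟨φ.ker, inferInstance, hker.to_subtype, ?_⟩,
    fun hmul hinj => ?_⟩
  · exact Subgroup.isNilpotent_of_ker_le_center (QuotientGroup.kerLift φ)
      (by rw [(MonoidHom.ker_eq_bot_iff _).2 (QuotientGroup.kerLift_injective φ)]; exact bot_le)
  · have hiter : ∀ g, ∀ k : ℕ, (A g)^[k + 1] = A (g ^ (k + 1)) := by
      intro g k
      induction k with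
      | zero => simp
      | succ k ih => rw [Function.iterate_succ', ih, pow_succ' g (k + 1), hmul]
    have : Finite φ.ker := hker.to_subtype
    have hid : ∀ g ∈ φ.ker, A g = id := by
      intro g hg
      obtain ⟨k, hk, hgk⟩ := (isOfFinOrder_of_finite (⟨g, hg⟩ : φ.ker)).exists_pow_eq_one
      have hgk' : g ^ k = 1 := congrArg Subtype.val hgk
      refine (hbilip g).eq_id_of_iterate_eq_iterate (k := k + 1) (l := 0 + 1) (by omega) ?_
      rw [hiter, hiter, pow_succ, hgk', one_mul, zero_add, pow_one]
    refine Subgroup.isNilpotent_of_ker_le_center φ fun g hg => ?_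
    have : g = 1 := hinj ((hid g hg).trans (hid 1 φ.ker.one_mem).symm)
    rw [this]
    exact Subgroup.one_mem _
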